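/- Let $\mathcal A$ be a finite alphabet, and for every $a\in\mathcal A$ let $\ell_a>0$ and let $f_a\in L^2(0,\ell_a)$ be real-valued. Let $\Omega\subseteq\mathcal A^{\mathbb Z}$ be a subshift, that is, a closed set with $T(\Omega)=\Omega$ for the shift $(T\omega)(n)=\omega(n+1)$, and let $\mu$ be a $T$-ergodic Borel probability measure on $\Omega$. For $\omega\in\Omega$ let $V_\omega:\mathbb R\to\mathbb R$ be the concatenation of the pieces $f_{\omega_n}$, $n\in\mathbb Z$, the piece $f_{\omega_0}$ being placed on $[0,\ell_{\omega_0})$. For $E,x,x_0\in\mathbb R$ let $A_{E,\omega}(x,x_0)$ be the unique real $2\times 2$ matrix of determinant $1$ such that $$A_{E,\omega}(x,x_0)\begin{pmatrix}y'(x_0)\\ y(x_0)\end{pmatrix}=\begin{pmatrix}y'(x)\\ y(x)\end{pmatrix}$$ for every solution $y$ of $-y''+V_\omega y=Ey$ (that is, $y$ is differentiable, $y'$ is locally absolutely continuous and the equation holds almost everywhere). For $n\in\mathbb N$ put $A^n_{E,\omega}=A_{E,\omega}(\ell_{\omega_0}+\cdots+\ell_{\omega_{n-1}},0)$. Let $s=\sum_{a\in\mathcal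 A}\ell_a\,\mu(\{\omega\in\Omega:\omega_0=a\})$, and let $\|\cdot\|$ be the operator norm for the Euclidean norm on $\mathbb R^2$. Then for every $E\in\mathbb R$ there is a constant $L_{\mathrm{disc}}(E)\in\mathbb R$ with $$\lim_{n\to\infty}\frac1n\log\|A^n_{E,\omega}\|=L_{\mathrm{disc}}(E)\quad\text{for $\mu$-almost every }\omega\in\Omega,$$ and for $\mu$-almost every $\omega\in\Omega$ the continuum Lyapunov exponent $L(E)=\lim_{x\to\infty}\frac1x\log\|A_{E,\omega}(x,0)\|$ exists and $$L(E)=\frac{L_{\mathrm{disc}}(E)}{s}.$$ -/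

import Mathlib

open MeasureTheory Filter Topology
open scoped Matrix.Norms.L2Operator

/-! ### Concatenation of functions -/

/-- The left end point of the `n`-th piece when pieces of lengths `len n` are laid out along the
line with the left end of piece `0` at the origin: `len 0 + ⋯ + len (n - 1)` for `0 ≤ n` and
`-(len n + ⋯ + len (-1))` for `n < 0`. -/
noncomputable def breakpoint (len : ℤ → ℝ) (n : ℤ) : ℝ :=
  ∑ k ∈ Finset.Ico 0 n, len k - ∑ k ∈ Finset.Ico n 0, len k

/-- The concatenation `( ⋯ f (-1) | [f 0] | f 1 ⋯ )` of functions `f n` on `[0, len n)`.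
For positive lengths the sum has at most one nonzero term. Values of `f n` outside
`[0, len n)` play no role. -/
noncomputable def concatenation (len : ℤ → ℝ) (f : ℤ → ℝ → ℝ) (x : ℝ) : ℝ :=
  ∑ᶠ n : ℤ, (Set.Ico (breakpoint len n) (breakpoint len (n + 1))).indicator
    (fun t => f n (t - breakpoint len n)) x

theorem breakpoint_zero (len : ℤ → ℝ) : breakpoint len 0 = 0 := by
  simp [breakpoint]

theorem breakpoint_succ (len : ℤ → ℝ) (n : ℤ) :
    breakpoint len (n + 1) = breakpoint len n + len n := by
  unfold breakpoint
  rcases le_or_gt 0 n with hn | hn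
  · rw [Finset.Ico_eq_empty (a := n + 1) (by lia), Finset.Ico_eq_empty (a := n) (by lia),
      ← Finset.insert_Ico_right_eq_Ico_add_one hn, Finset.sum_insert (by simp)]
    simp
    ring
  · rw [Finset.Ico_eq_empty (b := n + 1) (by lia), Finset.Ico_eq_empty (b := n) (by lia),
      ← Finset.insert_Ico_add_one_left_eq_Ico hn, Finset.sum_insert (by simp)]
    simp

theorem breakpoint_strictMono {len : ℤ → ℝ} (h : ∀ n, 0 < len n) :
    StrictMono (breakpoint len) :=
  strictMono_int_of_lt_succ fun n => by rw [breakpoint_succ]; linarith [h n]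

theorem concatenation_of_mem {len : ℤ → ℝ} (h : ∀ n, 0 < len n) (f : ℤ → ℝ → ℝ) {n : ℤ} {x : ℝ}
    (hx : x ∈ Set.Ico (breakpoint len n) (breakpoint len (n + 1))) :
    concatenation len f x = f n (x - breakpoint len n) := by
  unfold concatenation
  rw [finsum_eq_single _ n, Set.indicator_of_mem hx]
  intro m hm
  refine Set.indicator_of_notMem (fun hxm => hm ?_) _
  have h1 := (breakpoint_strictMono h).lt_iff_lt.1 (hx.1.trans_lt hxm.2)
  have h2 := (breakpoint_strictMono h).lt_iff_lt.1 (hxm.1.trans_lt hx.2)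
  lia

/-! ### Subshifts and the associated potentials -/

/-- The left shift on two-sided sequences. -/
def leftShift {𝒜 : Type*} (ω : ℤ → 𝒜) : ℤ → 𝒜 := fun n => ω (n + 1)

/-- A subshift: a closed set of two-sided sequences that equals its image under the shift. -/
structure IsSubshift {𝒜 : Type*} [TopologicalSpace 𝒜] (Ω : Set (ℤ → 𝒜)) : Prop where
  isClosed : IsClosed Ω
  image_eq : leftShift '' Ω = Ω

/-- The shift as a map of a subshift to itself. -/
def IsSubshift.shift {𝒜 : Type*} [TopologicalSpace 𝒜] {Ω : Set (ℤ → 𝒜)} (hΩ : IsSubshift Ω) :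
    Ω → Ω :=
  Set.MapsTo.restrict leftShift Ω Ω (Set.mapsTo_iff_image_subset.2 hΩ.image_eq.subset)

/-- The potential `( ⋯ f (ω (-1)) | [f (ω 0)] | f (ω 1) ⋯ )` of the sequence `ω`. -/
noncomputable def potential {𝒜 : Type*} (ℓ : 𝒜 → ℝ) (f : 𝒜 → ℝ → ℝ) (ω : ℤ → 𝒜) : ℝ → ℝ :=
  concatenation (fun n => ℓ (ω n)) (fun n => f (ω n))

theorem locallyIntegrable_potential {𝒜 : Type*} [Finite 𝒜] {ℓ : 𝒜 → ℝ} (hℓ : ∀ a, 0 < ℓ a)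
    {f : 𝒜 → ℝ → ℝ} (hf : ∀ a, MemLp (f a) 2 (volume.restrict (Set.Ioo 0 (ℓ a))))
    (ω : ℤ → 𝒜) : LocallyIntegrable (potential ℓ f ω) := by
  have : Nonempty 𝒜 := ⟨ω 0⟩
  obtain ⟨a₀, ha₀⟩ := Finite.exists_min ℓ
  set p := breakpoint (fun n => ℓ (ω n)) with hp
  have hpos : ∀ n, 0 < ℓ (ω n) := fun n => hℓ _
  have hup : ∀ N : ℕ, N * ℓ a₀ ≤ p N := by
    intro N
    induction N with
    | zero => simp [hp, breakpoint_zero]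
    | succ N ih =>
      have h1 : p ((N : ℤ) + 1) = p N + ℓ (ω N) := breakpoint_succ _ _
      have := ha₀ (ω N)
      push_cast
      rw [h1]
      linarith
  have hdn : ∀ N : ℕ, p (-(N : ℤ)) ≤ -(N * ℓ a₀) := by
    intro N
    induction N with
    | zero => simp [hp, breakpoint_zero]
    | succ N ih =>
      have h1 : p (-((N : ℤ) + 1) + 1) = p (-((N : ℤ) + 1)) + ℓ (ω (-((N : ℤ) + 1))) :=
        breakpoint_succ _ _
      rw [show -((N : ℤ) + 1) + 1 = -(N : ℤ) by ring] at h1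
      have := ha₀ (ω (-((N : ℤ) + 1)))
      push_cast
      linarith
  have hpiece : ∀ n, IntegrableOn (potential ℓ f ω) (Set.Ico (p n) (p (n + 1))) := by
    intro n
    have h1 : IntegrableOn (f (ω n)) (Set.Ioo 0 (ℓ (ω n))) := (hf (ω n)).integrable (by norm_num)
    have h2 : IntegrableOn (f (ω n)) (Set.Ico 0 (ℓ (ω n))) :=
      (integrableOn_Ico_iff_integrableOn_Ioo (by simp)).2 h1
    have h3 : IntegrableOn (fun x => f (ω n) (x - p n)) (Set.Ico (p n) (p (n + 1))) := by
      have h4 := (measurePreserving_sub_right volume (p n)).integrableOn_comp_preimage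
        (MeasurableEquiv.subRight (p n)).measurableEmbedding (f := f (ω n))
        (s := Set.Ico 0 (ℓ (ω n)))
      have h5 : (fun x => x - p n) ⁻¹' Set.Ico 0 (ℓ (ω n)) = Set.Ico (p n) (p (n + 1)) := by
        rw [show p (n + 1) = p n + ℓ (ω n) from breakpoint_succ _ _]
        simp [add_comm]
      rw [h5] at h4
      exact h4.2 h2
    exact h3.congr_fun (fun x hx => (concatenation_of_mem hpos (fun n => f (ω n)) hx).symm) measurableSet_Ico
  have hcover : ∀ N : ℕ, IntegrableOn (potential ℓ f ω) (Set.Ico (p (-(N : ℤ))) (p N)) := by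
    intro N
    induction N with
    | zero => simp
    | succ N ih =>
      have h1 := hpiece N
      have h2 := hpiece (-((N : ℤ) + 1))
      rw [show -((N : ℤ) + 1) + 1 = -(N : ℤ) by ring] at h2
      refine ((h2.union ih).union h1).mono_set fun x hx => ?_
      push_cast at hx
      rcases lt_or_ge x (p (-(N : ℤ))) with h | h
      · exact Or.inl (Or.inl ⟨hx.1, h⟩)
      · rcases lt_or_ge x (p N) with h3 | h3
        · exact Or.inl (Or.inr ⟨h, h3⟩)
        · exact Or.inr ⟨h3, hx.2⟩
  intro x
  obtain ⟨N, hN⟩ := exists_nat_gt (|x| / ℓ a₀)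
  have hN2 : |x| < N * ℓ a₀ := (div_lt_iff₀ (hℓ a₀)).1 hN
  obtain ⟨h1, h2⟩ := abs_lt.1 hN2
  exact ⟨_, Ico_mem_nhds ((hdn N).trans_lt h1) (h2.trans_le (hup N)), hcover N⟩

/-! ### Solutions and transfer matrices -/

/-- `y` is a (real) solution on the line of `-y″ + V y = E y`: it is differentiable with locally
absolutely continuous derivative, and the equation holds almost everywhere. -/
structure IsSchrodingerSolution (V : ℝ → ℝ) (E : ℝ) (y : ℝ → ℝ) : Prop where
  differentiable : Differentiable ℝ y
  absolutelyContinuous_deriv : ∀ a b : ℝ, AbsolutelyContinuousOnInterval (deriv y) a b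
  equation : ∀ᵐ x : ℝ, -deriv (deriv y) x + V x * y x = E * y x

/-- `A` is a unimodular matrix that takes `(y′(x₀), y(x₀))` to `(y′(x), y(x))` for every solution `y`. -/
def IsTransferMatrix (V : ℝ → ℝ) (E x x₀ : ℝ) (A : Matrix (Fin 2) (Fin 2) ℝ) : Prop :=
  A.det = 1 ∧ ∀ y : ℝ → ℝ, IsSchrodingerSolution V E y →
    A.mulVec ![deriv y x₀, y x₀] = ![deriv y x, y x]

theorem IsSchrodingerSolution.wronskian {V : ℝ → ℝ} {E : ℝ} {y z : ℝ → ℝ}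
    (hy : IsSchrodingerSolution V E y) (hz : IsSchrodingerSolution V E z) (a b : ℝ) :
    deriv y a * z a - y a * deriv z a = deriv y b * z b - y b * deriv z b := by
  have hc : ∀ {w : ℝ → ℝ}, IsSchrodingerSolution V E w → Continuous (deriv w) := by
    intro w hw
    refine continuous_iff_continuousAt.2 fun t => ?_
    have := (hw.absolutelyContinuous_deriv (t - 1) (t + 1)).continuousOn
    refine this.continuousAt ?_
    rw [Set.uIcc_of_le (by linarith)]
    exact Icc_mem_nhds (by linarith) (by linarith)
  have hac : ∀ {w : ℝ → ℝ}, IsSchrodingerSolution V E w →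
      AbsolutelyContinuousOnInterval w a b := by
    intro w hw
    apply ContDiffOn.absolutelyContinuousOnInterval
    exact (contDiff_one_iff_deriv.2 ⟨hw.differentiable, hc hw⟩).contDiffOn
  have hd : ∀ {w : ℝ → ℝ}, IsSchrodingerSolution V E w →
      ∀ᵐ x : ℝ, x ∈ Set.uIcc a b → HasDerivAt (deriv w) ((V x - E) * w x) x := by
    intro w hw
    filter_upwards [(hw.absolutelyContinuous_deriv a b).ae_differentiableAt, hw.equation]
      with x h1 h2 hx
    have := (h1 hx).hasDerivAt
    rwa [show deriv (deriv w) x = (V x - E) * w x by linarith] at this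
  have hW : AbsolutelyContinuousOnInterval (deriv y * z - y * deriv z) a b :=
    ((hy.absolutelyContinuous_deriv a b).mul (hac hz)).sub
      ((hac hy).mul (hz.absolutelyContinuous_deriv a b))
  obtain ⟨C, hC⟩ := hW.const_of_ae_hasDerivAt_zero (by
    filter_upwards [hd hy, hd hz] with x h1 h2 hx
    have h3 := ((h1 hx).mul (hz.differentiable x).hasDerivAt).sub
      ((hy.differentiable x).hasDerivAt.mul (h2 hx))
    convert h3 using 1
    ring)
  have h1 := hC a Set.left_mem_uIcc
  have h2 := hC b Set.right_mem_uIcc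
  simp only [Pi.sub_apply, Pi.mul_apply] at h1 h2
  rw [h1, h2]

theorem abs_integral_mul_exp_le {b : ℝ → ℝ} (hb : LocallyIntegrable b) (hb0 : ∀ t, 0 ≤ b t)
    (x₀ x : ℝ) :
    |∫ t in x₀..x, b t * Real.exp (2 * |∫ r in x₀..t, b r|)| ≤
      Real.exp (2 * |∫ r in x₀..x, b r|) / 2 := by
  set β : ℝ → ℝ := fun t => ∫ r in x₀..t, b r with hβ
  have hint : ∀ u v, IntervalIntegrable b volume u v := fun u v =>
    (hb.integrableOn_isCompact isCompact_uIcc).intervalIntegrable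
  have hmono : Monotone β := by
    intro u v huv
    have : β v - β u = ∫ r in u..v, b r :=
      intervalIntegral.integral_interval_sub_left (hint _ _) (hint _ _)
    have h2 : 0 ≤ ∫ r in u..v, b r := intervalIntegral.integral_nonneg huv fun t _ => hb0 t
    linarith
  have h0 : β x₀ = 0 := by simp [hβ]
  have hder : ∀ᵐ t, HasDerivAt β (b t) t := by
    filter_upwards [LocallyIntegrable.ae_hasDerivAt_integral hb] with t ht using ht x₀
  rcases le_total x₀ x with hx | hx
  · have hm : MonotoneOn (fun t => Real.exp (2 * β t) / 2) (Set.uIcc x₀ x) := by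
      intro u _ v _ huv
      have := hmono huv
      dsimp only
      gcongr
    have key := hm.intervalIntegral_deriv_mem_uIcc
    have hnn : Real.exp (2 * β x₀) / 2 ≤ Real.exp (2 * β x) / 2 := by
      have := hmono hx; gcongr
    rw [Set.uIcc_of_le (by linarith)] at key
    have heq : ∫ t in x₀..x, b t * Real.exp (2 * |β t|) =
        ∫ t in x₀..x, deriv (fun t => Real.exp (2 * β t) / 2) t := by
      apply intervalIntegral.integral_congr_ae
      filter_upwards [hder] with t ht hmem
      rw [Set.uIoc_of_le hx] at hmem
      have h1 : 0 ≤ β t := h0 ▸ hmono hmem.1.le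
      rw [abs_of_nonneg h1, (((ht.const_mul 2).exp).div_const 2).deriv]
      ring
    rw [heq, abs_of_nonneg key.1, abs_of_nonneg (h0 ▸ hmono hx)]
    have : 0 < Real.exp (2 * β x₀) / 2 := by positivity
    linarith [key.2]
  · have hm : MonotoneOn (fun t => -(Real.exp (-(2 * β t)) / 2)) (Set.uIcc x x₀) := by
      intro u _ v _ huv
      have := hmono huv
      dsimp only
      gcongr
    have key := hm.intervalIntegral_deriv_mem_uIcc
    have hnn : Real.exp (-(2 * β x₀)) / 2 ≤ Real.exp (-(2 * β x)) / 2 := by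
      have := hmono hx; gcongr
    rw [Set.uIcc_of_le (by linarith)] at key
    have heq : ∫ t in x..x₀, b t * Real.exp (2 * |β t|) =
        ∫ t in x..x₀, deriv (fun t => -(Real.exp (-(2 * β t)) / 2)) t := by
      apply intervalIntegral.integral_congr_ae
      filter_upwards [hder] with t ht hmem
      rw [Set.uIoc_of_le hx] at hmem
      have h1 : β t ≤ 0 := h0 ▸ hmono hmem.2
      have hd : HasDerivAt (fun t => -(Real.exp (-(2 * β t)) / 2))
          (-(Real.exp (-(2 * β t)) * -(2 * b t) / 2)) t :=
        (((ht.const_mul 2).fun_neg.exp).div_const 2).fun_neg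
      rw [abs_of_nonpos h1, hd.deriv, show 2 * -β t = -(2 * β t) by ring]
      ring
    rw [intervalIntegral.integral_symm, abs_neg, heq, abs_of_nonneg key.1,
      abs_of_nonpos (h0 ▸ hmono hx)]
    have : 0 < Real.exp (-(2 * β x₀)) / 2 := by positivity
    have h3 : 2 * -β x = -(2 * β x) := by ring
    rw [h3]
    linarith [key.2]

theorem exists_isSchrodingerSolution {V : ℝ → ℝ} (hV : LocallyIntegrable V) (E x₀ c d : ℝ) :
    ∃ y, IsSchrodingerSolution V E y ∧ deriv y x₀ = c ∧ y x₀ = d := by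
  set b : ℝ → ℝ := fun t => 1 + |V t - E| with hbdef
  have hq : LocallyIntegrable (fun t => V t - E) := hV.sub (locallyIntegrable_const E)
  have hb : LocallyIntegrable b := by
    refine (locallyIntegrable_const (1 : ℝ)).add fun t => ?_
    obtain ⟨s, hs, h⟩ := hq t
    exact ⟨s, hs, h.norm⟩
  have hb0 : ∀ t, 0 ≤ b t := fun t => by positivity
  have hint : ∀ {f : ℝ → ℝ}, LocallyIntegrable f → ∀ u v, IntervalIntegrable f volume u v :=
    fun hf u v => (hf.integrableOn_isCompact isCompact_uIcc).intervalIntegrable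
  set g : ℝ → ℝ := fun t => 2 * |∫ r in x₀..t, b r| with hgdef
  have hg : Continuous g :=
    ((intervalIntegral.continuous_primitive (hint hb) x₀).abs).const_mul 2
  set L : ℝ → ℝ × ℝ → ℝ × ℝ := fun t u => ((V t - E) * u.2, u.1) with hL
  have hLn : ∀ t u, ‖L t u‖ ≤ b t * ‖u‖ := by
    intro t u
    have h1 : ‖u.1‖ ≤ ‖u‖ := norm_fst_le u
    have h2 : ‖u.2‖ ≤ ‖u‖ := norm_snd_le u
    have h3 : 0 ≤ ‖u‖ := norm_nonneg u
    have h4 := abs_nonneg (V t - E)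
    refine max_le ?_ ?_
    · simp only [hL, hbdef, norm_mul, Real.norm_eq_abs] at *; nlinarith
    · simp only [hL, hbdef]; nlinarith
  have hLi : ∀ {u : ℝ → ℝ × ℝ}, Continuous u → ∀ p q,
      IntervalIntegrable (fun t => L t (u t)) volume p q := by
    intro u hu p q
    have h1 : IntervalIntegrable (fun t => (V t - E) * (u t).2) volume p q :=
      (hint hq p q).mul_continuousOn hu.snd.continuousOn
    have h2 : IntervalIntegrable (fun t => (u t).1) volume p q := hu.fst.intervalIntegrable p q
    exact ⟨h1.1.prodMk h2.1, h1.2.prodMk h2.2⟩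
  have hbound : ∀ (w : BoundedContinuousFunction ℝ (ℝ × ℝ)) (x : ℝ),
      ‖Real.exp (-g x) • ∫ t in x₀..x, L t (Real.exp (g t) • w t)‖ ≤ ‖w‖ / 2 := by
    intro w x
    have h1 : ‖∫ t in x₀..x, L t (Real.exp (g t) • w t)‖ ≤
        |∫ t in x₀..x, ‖w‖ * (b t * Real.exp (g t))| := by
      apply intervalIntegral.norm_integral_le_abs_of_norm_le
      · refine Eventually.of_forall fun t => (hLn t _).trans ?_
        rw [norm_smul, Real.norm_eq_abs, Real.abs_exp]
        have := w.norm_coe_le_norm t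
        have h5 : 0 ≤ b t * Real.exp (g t) := mul_nonneg (hb0 t) (Real.exp_pos _).le
        nlinarith
      · exact ((hint hb _ _).mul_continuousOn (by fun_prop)).const_mul _
    rw [intervalIntegral.integral_const_mul, abs_mul, abs_of_nonneg (norm_nonneg w)] at h1
    have h2 := abs_integral_mul_exp_le hb hb0 x₀ x
    rw [norm_smul, Real.norm_eq_abs, Real.abs_exp]
    calc _ ≤ Real.exp (-g x) * (‖w‖ * (Real.exp (g x) / 2)) := by
          gcongr
          exact h1.trans (by gcongr)
      _ = ‖w‖ / 2 * (Real.exp (-g x) * Real.exp (g x)) := by ring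
      _ = ‖w‖ / 2 := by rw [← Real.exp_add]; simp
  have hg0 : ∀ t, 0 ≤ g t := fun t => by positivity
  have hcu : ∀ w : BoundedContinuousFunction ℝ (ℝ × ℝ),
      Continuous fun t => Real.exp (g t) • w t := fun w => by fun_prop
  let Φ : BoundedContinuousFunction ℝ (ℝ × ℝ) → BoundedContinuousFunction ℝ (ℝ × ℝ) := fun w =>
    BoundedContinuousFunction.ofNormedAddCommGroup
      (fun x => Real.exp (-g x) • ((c, d) + ∫ t in x₀..x, L t (Real.exp (g t) • w t)))
      (by
        have := intervalIntegral.continuous_primitive (hLi (hcu w)) x₀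
        fun_prop)
      (‖(c, d)‖ + ‖w‖ / 2)
      (by
        intro x
        rw [smul_add]
        refine (norm_add_le _ _).trans (add_le_add ?_ (hbound w x))
        rw [norm_smul, Real.norm_eq_abs, Real.abs_exp]
        have : Real.exp (-g x) ≤ 1 := Real.exp_le_one_iff.2 (by linarith [hg0 x])
        have h3 := norm_nonneg (c, d)
        nlinarith)
  have hΦ : ContractingWith (1 / 2) Φ := by
    refine ⟨by rw [← NNReal.coe_lt_coe]; norm_num, LipschitzWith.of_dist_le_mul fun w w' => ?_⟩
    rw [BoundedContinuousFunction.dist_le (by positivity)]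
    intro x
    have h1 : Φ w x - Φ w' x =
        Real.exp (-g x) • ∫ t in x₀..x, L t (Real.exp (g t) • (w - w') t) := by
      change Real.exp (-g x) • ((c, d) + ∫ t in x₀..x, L t (Real.exp (g t) • w t)) -
        Real.exp (-g x) • ((c, d) + ∫ t in x₀..x, L t (Real.exp (g t) • w' t)) = _
      rw [← smul_sub, add_sub_add_left_eq_sub,
        ← intervalIntegral.integral_sub (hLi (hcu w) _ _) (hLi (hcu w') _ _)]
      congr 2
      ext t
      · simp [hL]; ring
      · simp [hL]; ring
    rw [dist_eq_norm, h1, dist_eq_norm]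
    refine (hbound _ x).trans (le_of_eq ?_)
    push_cast
    ring
  obtain ⟨w, hw, -⟩ := hΦ.exists_fixedPoint 0 (edist_ne_top _ _)
  set u : ℝ → ℝ × ℝ := fun t => Real.exp (g t) • w t with hu
  have huc : Continuous u := hcu w
  have hue : ∀ x, u x = (c, d) + ∫ t in x₀..x, L t (u t) := by
    intro x
    have h1 : w x = Real.exp (-g x) • ((c, d) + ∫ t in x₀..x, L t (u t)) :=
      congrArg (fun f : BoundedContinuousFunction ℝ (ℝ × ℝ) => f x) hw.symm
    simp only [hu]
    rw [h1, smul_smul, ← Real.exp_add]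
    simp
    rfl
  have hu1 : ∀ x, (u x).1 = c + ∫ t in x₀..x, (V t - E) * (u t).2 := by
    intro x
    have := (ContinuousLinearMap.fst ℝ ℝ ℝ).intervalIntegral_comp_comm (hLi huc x₀ x)
    conv_lhs => rw [hue x]
    simpa [hL] using this.symm
  have hu2 : ∀ x, (u x).2 = d + ∫ t in x₀..x, (u t).1 := by
    intro x
    have := (ContinuousLinearMap.snd ℝ ℝ ℝ).intervalIntegral_comp_comm (hLi huc x₀ x)
    conv_lhs => rw [hue x]
    simpa [hL] using this.symm
  have hd : ∀ x, HasDerivAt (fun t => (u t).2) (u x).1 x := by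
    intro x
    rw [funext hu2]
    exact (huc.fst.integral_hasStrictDerivAt x₀ x).hasDerivAt.const_add d
  have hderiv : deriv (fun t => (u t).2) = fun t => (u t).1 := funext fun x => (hd x).deriv
  have hql : LocallyIntegrable fun t => (V t - E) * (u t).2 :=
    hq.mul_continuous huc.snd
  refine ⟨fun t => (u t).2, ⟨fun x => (hd x).differentiableAt, ?_, ?_⟩, ?_, ?_⟩
  · intro p q
    rw [hderiv]
    have h1 := (hint hql p q).absolutelyContinuousOnInterval_intervalIntegral
      (c := p) Set.left_mem_uIcc
    have h2 : AbsolutelyContinuousOnInterval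
        (fun _ : ℝ => c + ∫ t in x₀..p, (V t - E) * (u t).2) p q :=
      (LipschitzOnWith.absolutelyContinuousOnInterval (K := 0)
        ((LipschitzWith.const _).lipschitzOnWith))
    have h3 : (fun t => (u t).1) = (fun _ : ℝ => c + ∫ t in x₀..p, (V t - E) * (u t).2) +
        fun x => ∫ t in p..x, (V t - E) * (u t).2 := by
      funext x
      rw [hu1 x, Pi.add_apply, add_assoc,
        intervalIntegral.integral_add_adjacent_intervals (hint hql _ _) (hint hql _ _)]
    rw [h3]
    exact h2.add h1
  · rw [hderiv]
    filter_upwards [LocallyIntegrable.ae_hasDerivAt_integral hql] with x hx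
    have h1 : HasDerivAt (fun t => (u t).1) ((V x - E) * (u x).2) x := by
      rw [funext hu1]
      exact (hx x₀).const_add c
    rw [h1.deriv]
    ring
  · rw [hderiv]
    simp [hu1 x₀]
  · simp [hu2 x₀]

theorem existsUnique_isTransferMatrix {V : ℝ → ℝ} (hV : LocallyIntegrable V) (E x x₀ : ℝ) :
    ∃! A, IsTransferMatrix V E x x₀ A := by
  obtain ⟨u, hu, hu1, hu2⟩ := exists_isSchrodingerSolution hV E x₀ 1 0
  obtain ⟨v, hv, hv1, hv2⟩ := exists_isSchrodingerSolution hV E x₀ 0 1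
  have huv := hu.wronskian hv x₀ x
  rw [hu1, hu2, hv1, hv2] at huv
  refine ⟨!![deriv u x, deriv v x; u x, v x], ⟨?_, ?_⟩, ?_⟩
  · rw [Matrix.det_fin_two_of]
    linarith
  · intro y hy
    have h1 := hy.wronskian hu x₀ x
    have h2 := hy.wronskian hv x₀ x
    rw [hu1, hu2] at h1
    rw [hv1, hv2] at h2
    ext i
    fin_cases i
    · simp [Matrix.mulVec, dotProduct]
      linear_combination deriv u x * h2 - deriv v x * h1 - deriv y x * huv
    · simp [Matrix.mulVec, dotProduct]
      linear_combination u x * h2 - v x * h1 - y x * huv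
  · rintro A ⟨-, hA⟩
    have h1 := hA u hu
    have h2 := hA v hv
    rw [hu1, hu2] at h1
    rw [hv1, hv2] at h2
    have e1 := congrFun h1 0
    have e2 := congrFun h1 1
    have e3 := congrFun h2 0
    have e4 := congrFun h2 1
    simp [Matrix.mulVec, dotProduct] at e1 e2 e3 e4
    ext i j
    fin_cases i <;> fin_cases j <;> simp [e1, e2, e3, e4]

/-- The transfer matrix `A_E(x, x₀)`: the unique matrix with `IsTransferMatrix V E x x₀`, which
exists for every locally integrable `V`. -/
noncomputable def transferMatrix (V : ℝ → ℝ) (E x x₀ : ℝ) : Matrix (Fin 2) (Fin 2) ℝ :=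
  Classical.epsilon (IsTransferMatrix V E x x₀)

theorem isTransferMatrix_transferMatrix {V : ℝ → ℝ} (hV : LocallyIntegrable V) (E x x₀ : ℝ) :
    IsTransferMatrix V E x x₀ (transferMatrix V E x x₀) :=
  Classical.epsilon_spec (existsUnique_isTransferMatrix hV E x x₀).exists

/-- The transfer matrix over the word `ω 0 ⋯ ω (n - 1)`, that is, from `0` to
`ℓ (ω 0) + ⋯ + ℓ (ω (n - 1))`. -/
noncomputable def wordTransferMatrix {𝒜 : Type*} (ℓ : 𝒜 → ℝ) (f : 𝒜 → ℝ → ℝ) (E : ℝ)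
    (ω : ℤ → 𝒜) (n : ℕ) : Matrix (Fin 2) (Fin 2) ℝ :=
  transferMatrix (potential ℓ f ω) E (∑ k ∈ Finset.range n, ℓ (ω k)) 0

/-!
The matrices over words form a cocycle over the shift: the transfer matrix across the piece of a
letter `a` depends only on `a`, because transfer matrices compose, are translation covariant, and
depend only on the potential between the two points (`IsTransferMatrix.of_eqOn`, by constancy of
the Wronskian). As the alphabet is finite, the functions `log ‖A^n‖` are measurable, subadditive
along orbits, and bounded by a multiple of `n`.

The discrete exponent then comes from the subadditive ergodic theorem for such sequences
(`IsSubadditiveAlong.exists_ae_tendsto_div`). By subadditivity the lower growth rate is constant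
almost everywhere. Most points start a block of bounded length with nearly this rate, and the orbit
can be cut greedily into such blocks and a few exceptional single steps
(`IsSubadditiveAlong.le_add_birkhoffSum_indicator`). Integrated, this estimate gives the pointwise
ergodic theorem for bounded functions; together with the latter, which makes the exceptional steps
rare, it bounds the upper growth rate by the lower one.

The pointwise ergodic theorem also shows that the `n`-th break point lies at `s * n + o(n)`. Within
a piece, `log ‖A(x, 0)‖` differs by at most a constant from its value at the last break point: the
matrices over parts of pieces are bounded by compactness, and the inverse of a unimodular `2 × 2`
matrix has the same norm. Dividing by `x` in place of `n` therefore divides the growth rate by `s`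
(`tendsto_div_of_abs_sub_le`).
-/

/-! ### The subadditive ergodic theorem for bounded cocycles -/

/-- A sequence `g` of functions is subadditive along the orbits of `T`. -/
def IsSubadditiveAlong {X : Type*} (T : X → X) (g : ℕ → X → ℝ) : Prop :=
  ∀ m n x, g (m + n) x ≤ g m x + g n (T^[m] x)

theorem isSubadditiveAlong_birkhoffSum {X : Type*} (T : X → X) (φ : X → ℝ) :
    IsSubadditiveAlong T (birkhoffSum T φ) :=
  fun m n x => (birkhoffSum_add T φ m n x).le

/-- The covering estimate: cut the orbit segment of length `n` greedily into blocks of length at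
most `N` on which `g` grows at rate at most `c`, and into single steps at the points of the
exceptional set `H`, each of which costs at most `K` more. -/
theorem IsSubadditiveAlong.le_add_birkhoffSum_indicator {X : Type*} {T : X → X} {g : ℕ → X → ℝ}
    (hg : IsSubadditiveAlong T g) (hg0 : ∀ x, g 0 x = 0) {c K : ℝ} (hK : 0 ≤ K)
    (hg1 : ∀ x, g 1 x ≤ c + K) {N : ℕ} {H : Set X}
    (hH : ∀ x ∉ H, ∃ m, 1 ≤ m ∧ m ≤ N ∧ g m x ≤ c * m) (n : ℕ) (x : X) :
    g n x ≤ c * n + K * birkhoffSum T (H.indicator 1) n x + N * K := by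
  have hb : ∀ n x, 0 ≤ birkhoffSum T (H.indicator (1 : X → ℝ)) n x := fun n x =>
    Finset.sum_nonneg fun k _ => Set.indicator_nonneg (fun _ _ => zero_le_one) _
  -- Needed for the last block, which may reach beyond the segment; this is the term `N * K`.
  have htriv : ∀ n x, g n x ≤ n * (c + K) := by
    intro n
    induction n with
    | zero => intro x; simp [hg0]
    | succ n ih =>
      intro x
      have h1 := hg n 1 x
      have h2 := ih x
      have h3 := hg1 (T^[n] x)
      push_cast
      linarith
  induction n using Nat.strong_induction_on generalizing x with
  | _ n ih =>
  by_cases hx : x ∈ H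
  · rcases n with _ | n
    · simp only [hg0, birkhoffSum_zero]
      have : 0 ≤ N * K := by positivity
      simpa using this
    · have h1 := hg 1 n x
      rw [add_comm 1 n] at h1
      have h2 := ih n (by lia) (T^[1] x)
      have h3 : birkhoffSum T (H.indicator (1 : X → ℝ)) (n + 1) x =
          1 + birkhoffSum T (H.indicator 1) n (T^[1] x) := by
        rw [birkhoffSum_succ']; simp [hx]
      have h4 := hg1 x
      rw [h3]
      push_cast
      linarith
  · obtain ⟨m, hm1, hmN, hm⟩ := hH x hx
    rcases le_or_gt m n with hmn | hmn
    · obtain ⟨k, rfl⟩ := Nat.exists_eq_add_of_le hmn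
      have h1 := hg m k x
      have h2 := ih k (by lia) (T^[m] x)
      have h3 := birkhoffSum_add T (H.indicator (1 : X → ℝ)) m k x
      have h4 := mul_nonneg hK (hb m x)
      rw [h3]
      push_cast
      linarith
    · have h1 := htriv n x
      have h2 : (n : ℝ) ≤ N := by exact_mod_cast (hmn.trans_le hmN).le
      have h3 := mul_nonneg hK (hb n x)
      have h4 := mul_le_mul_of_nonneg_right h2 hK
      linarith

theorem abs_div_natCast_le {X : Type*} {g : ℕ → X → ℝ} {C : ℝ} (hC : ∀ n x, |g n x| ≤ C * n)
    (n : ℕ) (x : X) : |g n x / n| ≤ C := by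
  rcases Nat.eq_zero_or_pos n with rfl | hn
  · have h1 := hC 1 x
    have := abs_nonneg (g 1 x)
    simp at h1 ⊢
    linarith
  · rw [abs_div, Nat.abs_cast, div_le_iff₀ (by exact_mod_cast hn)]
    exact hC n x

theorem isBoundedUnder_ge_div {X : Type*} {g : ℕ → X → ℝ} {C : ℝ} (hC : ∀ n x, |g n x| ≤ C * n)
    (x : X) : IsBoundedUnder (· ≥ ·) atTop fun n : ℕ => g n x / n :=
  isBoundedUnder_of ⟨-C, fun n => (abs_le.1 (abs_div_natCast_le hC n x)).1⟩

theorem isBoundedUnder_le_div {X : Type*} {g : ℕ → X → ℝ} {C : ℝ} (hC : ∀ n x, |g n x| ≤ C * n)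
    (x : X) : IsBoundedUnder (· ≤ ·) atTop fun n : ℕ => g n x / n :=
  isBoundedUnder_of ⟨C, fun n => (abs_le.1 (abs_div_natCast_le hC n x)).2⟩

theorem abs_birkhoffSum_le {X : Type*} {T : X → X} {φ : X → ℝ} {C : ℝ} (hC : ∀ x, |φ x| ≤ C)
    (n : ℕ) (x : X) : |birkhoffSum T φ n x| ≤ C * n := by
  refine (Finset.abs_sum_le_sum_abs _ _).trans ?_
  refine (Finset.sum_le_card_nsmul _ _ C fun k _ => hC _).trans ?_
  simp [mul_comm]

section Ergodic

variable {X : Type*} [MeasurableSpace X] {μ : Measure X} {T : X → X} {g : ℕ → X → ℝ} {C : ℝ}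

/-- The lower growth rate does not decrease along orbits, hence is invariant almost everywhere,
and so is constant by ergodicity. -/
theorem IsSubadditiveAlong.exists_liminf_div_ae_eq_const [IsProbabilityMeasure μ]
    (hT : Ergodic T μ) (hg : IsSubadditiveAlong T g) (hgm : ∀ n, Measurable (g n))
    (hC : ∀ n x, |g n x| ≤ C * n) :
    ∃ c, ∀ᵐ x ∂μ, liminf (fun n : ℕ => g n x / n) atTop = c := by
  set u : X → ℝ := fun x => liminf (fun n : ℕ => g n x / n) atTop with hu
  have hum : Measurable u := Measurable.liminf fun n => (hgm n).div_const _
  have hle : ∀ x, u x ≤ u (T x) := by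
    intro x
    by_contra! h
    obtain ⟨d, hd1, hd2⟩ := exists_between h
    obtain ⟨e, he1, he2⟩ := exists_between hd2
    have h1 := frequently_lt_of_liminf_lt
      ((isBoundedUnder_le_div hC (T x)).isCoboundedUnder_ge) hd1
    have h2 := (tendsto_add_atTop_nat 1).eventually
      (eventually_lt_of_lt_liminf he2 (isBoundedUnder_ge_div hC x))
    obtain ⟨M, hM⟩ := exists_nat_gt ((C - e) / (e - d))
    obtain ⟨n, h3, h4, h5⟩ :=
      (h1.and_eventually (h2.and ((eventually_ge_atTop M).and (eventually_gt_atTop 0)))).exists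
    have hn : (0 : ℝ) < n := by exact_mod_cast h5.2
    rw [div_lt_iff₀ hn] at h3
    rw [lt_div_iff₀ (by positivity)] at h4
    have h6 := hg 1 n x
    rw [add_comm 1 n] at h6
    have h7 := (abs_le.1 (hC 1 x)).2
    have h8 : (M : ℝ) ≤ n := by exact_mod_cast h5.1
    rw [div_lt_iff₀ (by linarith)] at hM
    have h9 := mul_le_mul_of_nonneg_right h8 (by linarith : 0 ≤ e - d)
    simp only [Function.iterate_one] at h6
    push_cast at h4 h7
    linarith
  have hub : ∀ x, |u x| ≤ C := by
    intro x
    have hev := abs_div_natCast_le hC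
    rw [abs_le]
    constructor
    · exact le_liminf_of_le ((isBoundedUnder_le_div hC x).isCoboundedUnder_ge)
        (Eventually.of_forall fun n => (abs_le.1 (hev n x)).1)
    · exact liminf_le_of_frequently_le (Frequently.of_forall fun n => (abs_le.1 (hev n x)).2)
        (isBoundedUnder_ge_div hC x)
  have hui : Integrable u μ :=
    Integrable.of_bound hum.aestronglyMeasurable C (ae_of_all _ hub)
  have huT : Integrable (u ∘ T) μ := hT.toMeasurePreserving.integrable_comp_of_integrable hui
  -- `u ≤ u ∘ T` and both have the same integral, so they agree almost everywhere.
  have hint : ∫ x, u x ∂μ = ∫ x, (u ∘ T) x ∂μ := by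
    conv_lhs => rw [← hT.map_eq]
    exact integral_map hT.measurable.aemeasurable (hT.map_eq.symm ▸ hum.aestronglyMeasurable)
  have heq := (integral_eq_iff_of_ae_le hui huT (ae_of_all _ hle)).1 hint
  obtain ⟨c, hc⟩ := hT.ae_eq_const_of_ae_eq_comp_ae hum.aestronglyMeasurable heq.symm
  exact ⟨c, hc⟩

/-- If almost every point sees a block of rate below `c`, then the points that see none of length
at most `N` form a set of small measure for large `N`, and the covering estimate applies to it. -/
theorem IsSubadditiveAlong.exists_le_add_birkhoffSum_indicator [IsProbabilityMeasure μ]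
    (hg : IsSubadditiveAlong T g) (hgm : ∀ n, Measurable (g n)) (hC : ∀ n x, |g n x| ≤ C * n)
    {c : ℝ} (hc : ∀ᵐ x ∂μ, ∃ n : ℕ, 1 ≤ n ∧ g n x ≤ c * n) {δ : ℝ} (hδ : 0 < δ) :
    ∃ H : Set X, MeasurableSet H ∧ μ.real H ≤ δ ∧ ∃ N : ℕ, ∀ n x,
      g n x ≤ c * n + |C - c| * birkhoffSum T (H.indicator 1) n x + N * |C - c| := by
  let H : ℕ → Set X := fun N => {x | ∀ m, 1 ≤ m → m ≤ N → c * m < g m x}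
  have hHm : ∀ N, MeasurableSet (H N) := by
    intro N
    have : H N = ⋂ m, ⋂ (_ : 1 ≤ m), ⋂ (_ : m ≤ N), {x | c * m < g m x} := by
      ext x; simp [H]
    rw [this]
    exact MeasurableSet.iInter fun m => MeasurableSet.iInter fun _ => MeasurableSet.iInter fun _ =>
      measurableSet_lt measurable_const (hgm m)
  have hanti : Antitone H := fun N M hNM x hx m h1 h2 => hx m h1 (h2.trans hNM)
  have h0 : μ (⋂ N, H N) = 0 := by
    rw [measure_eq_zero_iff_ae_notMem]
    filter_upwards [hc] with x ⟨n, hn, hgn⟩ hx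
    exact absurd (Set.mem_iInter.1 hx n n hn le_rfl) (not_lt.2 hgn)
  have ht := tendsto_measure_iInter_atTop (μ := μ) (fun N => (hHm N).nullMeasurableSet) hanti
    ⟨0, measure_ne_top _ _⟩
  rw [h0] at ht
  obtain ⟨N, hN⟩ := (ht.eventually_le_const (ENNReal.ofReal_pos.2 hδ)).exists
  refine ⟨H N, hHm N, ENNReal.toReal_le_of_le_ofReal hδ.le hN, N, fun n x => ?_⟩
  refine hg.le_add_birkhoffSum_indicator (fun x => ?_) (abs_nonneg _) (fun x => ?_) ?_ n x
  · simpa using hC 0 x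
  · have h1 := (abs_le.1 (hC 1 x)).2
    have h2 := le_abs_self (C - c)
    push_cast at h1
    linarith
  · intro x hx
    simp only [H, Set.mem_ofPred_eq, not_forall, not_lt] at hx
    obtain ⟨m, h1, h2, h3⟩ := hx
    exact ⟨m, h1, h2, h3⟩

theorem measurable_birkhoffSum (hT : Measurable T) {φ : X → ℝ} (hφ : Measurable φ) (n : ℕ) :
    Measurable (birkhoffSum T φ n) :=
  Finset.measurable_sum _ fun k _ => hφ.comp (hT.iterate k)

theorem integral_birkhoffSum [IsProbabilityMeasure μ] (hT : MeasurePreserving T μ μ) {φ : X → ℝ}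
    (hφ : Integrable φ μ) (n : ℕ) : ∫ x, birkhoffSum T φ n x ∂μ = n * ∫ x, φ x ∂μ := by
  unfold birkhoffSum
  rw [integral_finsetSum (f := fun k x => φ (T^[k] x)) _ fun k _ =>
    (hT.iterate k).integrable_comp_of_integrable hφ]
  have : ∀ k, ∫ x, φ (T^[k] x) ∂μ = ∫ x, φ x ∂μ := by
    intro k
    have hk := hT.iterate k
    conv_rhs => rw [← hk.map_eq]
    exact (integral_map hk.measurable.aemeasurable
      (hk.map_eq.symm ▸ hφ.aestronglyMeasurable)).symm
  simp [this]

/-- The lower half of the pointwise ergodic theorem: the space average does not exceed the lower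
time average, as one sees by integrating the covering estimate. -/
theorem Ergodic.ae_eventually_lt_birkhoffSum [IsProbabilityMeasure μ] (hT : Ergodic T μ)
    {φ : X → ℝ} (hφ : Measurable φ) (hC : ∀ x, |φ x| ≤ C) :
    ∀ᵐ x ∂μ, ∀ ε > 0, ∀ᶠ n : ℕ in atTop, (∫ x, φ x ∂μ) - ε < birkhoffSum T φ n x / n := by
  have hsub := isSubadditiveAlong_birkhoffSum T φ
  have hm := measurable_birkhoffSum hT.measurable hφ
  have hb := abs_birkhoffSum_le (T := T) hC
  have hφi : Integrable φ μ := Integrable.of_bound hφ.aestronglyMeasurable C (ae_of_all _ hC)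
  obtain ⟨c₀, hc₀⟩ := hsub.exists_liminf_div_ae_eq_const hT hm hb
  have key : ∫ x, φ x ∂μ ≤ c₀ := by
    refine le_of_forall_gt_imp_ge_of_dense fun c hc => ?_
    have hc1 : ∀ᵐ x ∂μ, ∃ n : ℕ, 1 ≤ n ∧ birkhoffSum T φ n x ≤ c * n := by
      filter_upwards [hc₀] with x hx
      have h1 := frequently_lt_of_liminf_lt
        ((isBoundedUnder_le_div hb x).isCoboundedUnder_ge) (hx.trans_lt hc)
      obtain ⟨n, h2, h3⟩ := (h1.and_eventually (eventually_gt_atTop 0)).exists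
      have hn : (0 : ℝ) < n := by exact_mod_cast h3
      exact ⟨n, h3, ((div_lt_iff₀ hn).1 h2).le⟩
    set K := |C - c|
    -- The covering estimate for `n` steps, integrated, divided by `n`, and as `n → ∞`.
    have hδ : ∀ δ > 0, ∫ x, φ x ∂μ ≤ c + K * δ := by
      intro δ hδ
      obtain ⟨H, hH, hHδ, N, hN⟩ := hsub.exists_le_add_birkhoffSum_indicator hm hb hc1 hδ
      have hHi : Integrable (H.indicator (1 : X → ℝ)) μ := (integrable_const (1 : ℝ)).indicator hH
      have hbi : ∀ {ψ : X → ℝ}, Integrable ψ μ → ∀ n, Integrable (birkhoffSum T ψ n) μ :=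
        fun hψ n => integrable_finsetSum _ fun k _ =>
          (hT.toMeasurePreserving.iterate k).integrable_comp_of_integrable hψ
      have hn : ∀ n : ℕ, n * ∫ x, φ x ∂μ ≤ n * (c + K * δ) + N * K := by
        intro n
        have h1 : Integrable (fun x => c * n + K * birkhoffSum T (H.indicator 1) n x) μ :=
          (integrable_const _).add ((hbi hHi n).const_mul K)
        have := integral_mono (hbi hφi n) (h1.add (integrable_const (N * K))) (hN n)
        simp only [Pi.add_apply] at this
        rw [integral_add h1 (integrable_const _),
          integral_add (integrable_const _) ((hbi hHi n).const_mul K), integral_const_mul K,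
          integral_birkhoffSum hT.toMeasurePreserving hφi,
          integral_birkhoffSum hT.toMeasurePreserving hHi, integral_indicator_one hH] at this
        simp only [integral_const, probReal_univ, one_smul] at this
        have h2 : K * (n * μ.real H) ≤ K * (n * δ) := by gcongr
        linarith
      by_contra! hlt
      obtain ⟨n, hn'⟩ := exists_nat_gt (N * K / ((∫ x, φ x ∂μ) - (c + K * δ)))
      rw [div_lt_iff₀ (by linarith)] at hn'
      linarith [hn n]
    refine le_of_forall_pos_le_add fun ε hε => ?_
    refine (hδ (ε / (K + 1)) (by positivity)).trans ?_
    have : K * (ε / (K + 1)) ≤ ε := by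
      rw [mul_div_assoc', div_le_iff₀ (by positivity)]
      nlinarith
    linarith
  filter_upwards [hc₀] with x hx ε hε
  exact eventually_lt_of_lt_liminf (by rw [hx]; linarith) (isBoundedUnder_ge_div hb x)

/-- The pointwise ergodic theorem for bounded functions. -/
theorem Ergodic.ae_tendsto_birkhoffSum_div [IsProbabilityMeasure μ] (hT : Ergodic T μ)
    {φ : X → ℝ} (hφ : Measurable φ) (hC : ∀ x, |φ x| ≤ C) :
    ∀ᵐ x ∂μ, Tendsto (fun n : ℕ => birkhoffSum T φ n x / n) atTop (𝓝 (∫ x, φ x ∂μ)) := by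
  filter_upwards [hT.ae_eventually_lt_birkhoffSum hφ hC,
    hT.ae_eventually_lt_birkhoffSum hφ.neg (C := C) (by simpa using hC)] with x h1 h2
  rw [Metric.tendsto_nhds]
  intro ε hε
  filter_upwards [h1 ε hε, h2 ε hε] with n h3 h4
  simp only [Pi.neg_apply] at h4
  rw [integral_neg, birkhoffSum_neg, neg_div] at h4
  rw [Real.dist_eq, abs_lt]
  constructor <;> linarith

/-- The subadditive ergodic theorem for cocycles with `|g n| ≤ C * n`: the covering estimate,
with the frequency of the exceptional set given by the pointwise ergodic theorem, bounds the
upper growth rate by the lower one. -/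
theorem IsSubadditiveAlong.exists_ae_tendsto_div [IsProbabilityMeasure μ] (hT : Ergodic T μ)
    (hg : IsSubadditiveAlong T g) (hgm : ∀ n, Measurable (g n)) (hC : ∀ n x, |g n x| ≤ C * n) :
    ∃ c, ∀ᵐ x ∂μ, Tendsto (fun n : ℕ => g n x / n) atTop (𝓝 c) := by
  obtain ⟨c₀, hc₀⟩ := hg.exists_liminf_div_ae_eq_const hT hgm hC
  refine ⟨c₀, ?_⟩
  have key : ∀ ε > 0, ∀ᵐ x ∂μ, ∀ᶠ n : ℕ in atTop, g n x / n < c₀ + ε := by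
    intro ε hε
    set c := c₀ + ε / 4 with hcdef
    have hc1 : ∀ᵐ x ∂μ, ∃ n : ℕ, 1 ≤ n ∧ g n x ≤ c * n := by
      filter_upwards [hc₀] with x hx
      have h1 := frequently_lt_of_liminf_lt
        ((isBoundedUnder_le_div hC x).isCoboundedUnder_ge)
        (show liminf (fun n : ℕ => g n x / n) atTop < c by rw [hx]; linarith)
      obtain ⟨n, h2, h3⟩ := (h1.and_eventually (eventually_gt_atTop 0)).exists
      have hn : (0 : ℝ) < n := by exact_mod_cast h3
      exact ⟨n, h3, ((div_lt_iff₀ hn).1 h2).le⟩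
    set K := |C - c|
    have hK : 0 ≤ K := abs_nonneg _
    -- With exceptional frequency below `2 * δ`, the exceptional steps cost less than `ε / 4` per step.
    have hδ : 0 < ε / (8 * (K + 1)) := by positivity
    obtain ⟨H, hH, hHδ, N, hN⟩ := hg.exists_le_add_birkhoffSum_indicator hgm hC hc1 hδ
    have hHm : Measurable (H.indicator (1 : X → ℝ)) := measurable_one.indicator hH
    have hH1 : ∀ x, |H.indicator (1 : X → ℝ) x| ≤ 1 := by
      intro x
      by_cases hx : x ∈ H <;> simp [hx]
    filter_upwards [hT.ae_tendsto_birkhoffSum_div hHm hH1] with x hx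
    rw [integral_indicator_one hH] at hx
    have h1 := hx.eventually_lt_const
      (show μ.real H < 2 * (ε / (8 * (K + 1))) by linarith)
    obtain ⟨M, hM⟩ := exists_nat_gt (N * K / (ε / 4))
    filter_upwards [h1, eventually_ge_atTop M, eventually_gt_atTop 0] with n h2 h3 h4
    have hn : (0 : ℝ) < n := by exact_mod_cast h4
    rw [div_lt_iff₀ hn] at h2 ⊢
    rw [div_lt_iff₀ (by positivity)] at hM
    have h5 : (M : ℝ) ≤ n := by exact_mod_cast h3
    have h6 := hN n x
    have h7 : K * birkhoffSum T (H.indicator 1) n x ≤ ε / 4 * n := by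
      calc K * birkhoffSum T (H.indicator 1) n x
          ≤ K * (2 * (ε / (8 * (K + 1))) * n) := by gcongr
        _ = ε / 4 * n * (K / (K + 1)) := by field_simp; ring
        _ ≤ ε / 4 * n * 1 := by
          gcongr
          rw [div_le_one (by positivity)]
          linarith
        _ = ε / 4 * n := mul_one _
    have h8 : M * (ε / 4) ≤ n * (ε / 4) := by gcongr
    have h9 : 0 < n * ε := by positivity
    rw [hcdef] at h6
    linarith
  have key' : ∀ᵐ x ∂μ, ∀ k : ℕ, ∀ᶠ n : ℕ in atTop, g n x / n < c₀ + 1 / ((k : ℝ) + 1) :=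
    ae_all_iff.2 fun k => key _ (by positivity)
  filter_upwards [hc₀, key'] with x hx hk
  rw [Metric.tendsto_nhds]
  intro ε hε
  obtain ⟨k, hkε⟩ := exists_nat_one_div_lt hε
  filter_upwards [hk k, eventually_lt_of_lt_liminf
    (show c₀ - ε < liminf (fun n : ℕ => g n x / n) atTop by rw [hx]; linarith)
    (isBoundedUnder_ge_div hC x)] with n h1 h2
  rw [Real.dist_eq, abs_lt]
  constructor <;> linarith

end Ergodic

/-! ### Unimodular matrices -/

/-- The inverse of a `2 × 2` matrix of determinant `1` is a conjugate of its transpose by a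
rotation, so it has the same norm. -/
theorem Matrix.norm_adjugate_fin_two_le (A : Matrix (Fin 2) (Fin 2) ℝ) : ‖A.adjugate‖ ≤ ‖A‖ := by
  set J : Matrix (Fin 2) (Fin 2) ℝ := !![0, 1; -1, 0] with hJ
  have hJJ : J.conjTranspose * J = 1 := by
    ext i j
    fin_cases i <;> fin_cases j <;> simp [hJ, Matrix.mul_apply]
  have hJ1 : ‖J‖ = 1 := by
    have h1 := Matrix.l2_opNorm_conjTranspose_mul_self J
    rw [hJJ, norm_one] at h1
    nlinarith [norm_nonneg J]
  have hA : A.adjugate = J * A.conjTranspose * J.conjTranspose := by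
    rw [Matrix.adjugate_fin_two]
    ext i j
    fin_cases i <;> fin_cases j <;>
      simp [hJ, Matrix.mul_apply, Fin.sum_univ_two, Matrix.vecMul, dotProduct]
  calc ‖A.adjugate‖ ≤ ‖J‖ * ‖A.conjTranspose‖ * ‖J.conjTranspose‖ := by
        rw [hA]
        exact (norm_mul_le _ _).trans (by gcongr; exact norm_mul_le _ _)
    _ = ‖A‖ := by rw [Matrix.l2_opNorm_conjTranspose, Matrix.l2_opNorm_conjTranspose, hJ1]; ring

theorem Matrix.one_le_norm_of_det_eq_one {A : Matrix (Fin 2) (Fin 2) ℝ} (hA : A.det = 1) :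
    1 ≤ ‖A‖ := by
  have h1 : ‖A * A.adjugate‖ ≤ ‖A‖ * ‖A‖ :=
    (norm_mul_le _ _).trans (by gcongr; exact A.norm_adjugate_fin_two_le)
  rw [Matrix.mul_adjugate, hA, one_smul, norm_one] at h1
  nlinarith [norm_nonneg A]

/-- Left multiplication by a unimodular matrix `D` changes `log ‖A‖` by at most `log ‖D‖`. -/
theorem Matrix.abs_log_norm_mul_sub_le {D A : Matrix (Fin 2) (Fin 2) ℝ} (hD : D.det = 1)
    (hA : A.det = 1) : |Real.log ‖D * A‖ - Real.log ‖A‖| ≤ Real.log ‖D‖ := by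
  have h1 := Matrix.one_le_norm_of_det_eq_one hD
  have h2 := Matrix.one_le_norm_of_det_eq_one hA
  have h3 := Matrix.one_le_norm_of_det_eq_one (A := D * A) (by rw [Matrix.det_mul, hD, hA, one_mul])
  have h4 : ‖A‖ ≤ ‖D‖ * ‖D * A‖ := by
    calc ‖A‖ = ‖D.adjugate * (D * A)‖ := by
          rw [← Matrix.mul_assoc, Matrix.adjugate_mul, hD, one_smul, Matrix.one_mul]
      _ ≤ ‖D‖ * ‖D * A‖ :=
          (norm_mul_le _ _).trans (by gcongr; exact D.norm_adjugate_fin_two_le)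
  have h5 := Real.log_le_log (by linarith) h4
  have h6 := Real.log_le_log (by linarith) (norm_mul_le D A)
  rw [Real.log_mul (by linarith) (by linarith)] at h5 h6
  rw [abs_le]
  constructor <;> linarith

/-! ### Locality, translation and composition of transfer matrices -/

theorem IsSchrodingerSolution.continuous_deriv {V : ℝ → ℝ} {E : ℝ} {y : ℝ → ℝ}
    (hy : IsSchrodingerSolution V E y) : Continuous (deriv y) := by
  refine continuous_iff_continuousAt.2 fun t => ?_
  refine (hy.absolutelyContinuous_deriv (t - 1) (t + 1)).continuousOn.continuousAt ?_
  rw [Set.uIcc_of_le (by linarith)]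
  exact Icc_mem_nhds (by linarith) (by linarith)

/-- The Wronskian of solutions for two potentials is constant on an interval on which the
potentials agree. -/
theorem IsSchrodingerSolution.wronskian_of_eqOn {V W : ℝ → ℝ} {E : ℝ} {y z : ℝ → ℝ}
    (hy : IsSchrodingerSolution V E y) (hz : IsSchrodingerSolution W E z) {a b : ℝ} (hab : a ≤ b)
    (hVW : Set.EqOn V W (Set.Ico a b)) :
    deriv y a * z a - y a * deriv z a = deriv y b * z b - y b * deriv z b := by
  have hac : ∀ {U w : ℝ → ℝ}, IsSchrodingerSolution U E w →
      AbsolutelyContinuousOnInterval w a b := fun hw =>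
    ((contDiff_one_iff_deriv.2
      ⟨hw.differentiable, hw.continuous_deriv⟩).contDiffOn).absolutelyContinuousOnInterval
  have hd : ∀ {U w : ℝ → ℝ}, IsSchrodingerSolution U E w →
      ∀ᵐ x : ℝ, x ∈ Set.uIcc a b → HasDerivAt (deriv w) ((U x - E) * w x) x := by
    intro U w hw
    filter_upwards [(hw.absolutelyContinuous_deriv a b).ae_differentiableAt, hw.equation]
      with x h1 h2 hx
    have := (h1 hx).hasDerivAt
    rwa [show deriv (deriv w) x = (U x - E) * w x by linarith] at this
  have hW : AbsolutelyContinuousOnInterval (deriv y * z - y * deriv z) a b :=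
    ((hy.absolutelyContinuous_deriv a b).mul (hac hz)).sub
      ((hac hy).mul (hz.absolutelyContinuous_deriv a b))
  -- The potentials need not agree at `b` itself, which is a null set.
  have hb : ∀ᵐ x : ℝ, x ≠ b := by simp [ae_iff]
  obtain ⟨C, hC⟩ := hW.const_of_ae_hasDerivAt_zero (by
    filter_upwards [hd hy, hd hz, hb] with x h1 h2 hxb hx
    have h3 := ((h1 hx).mul (hz.differentiable x).hasDerivAt).sub
      ((hy.differentiable x).hasDerivAt.mul (h2 hx))
    rw [Set.uIcc_of_le hab] at hx
    convert h3 using 1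
    rw [hVW ⟨hx.1, hx.2.lt_of_ne hxb⟩]
    ring)
  have h1 := hC a Set.left_mem_uIcc
  have h2 := hC b Set.right_mem_uIcc
  simp only [Pi.sub_apply, Pi.mul_apply] at h1 h2
  rw [h1, h2]

/-- A transfer matrix depends only on the potential between the two points: its entries are the
values of the two basic solutions, and the Wronskians with these determine any solution of the
other equation. -/
theorem IsTransferMatrix.of_eqOn {V W : ℝ → ℝ} (hV : LocallyIntegrable V) {E a b : ℝ}
    (hab : a ≤ b) (hVW : Set.EqOn V W (Set.Ico a b)) {A : Matrix (Fin 2) (Fin 2) ℝ}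
    (hA : IsTransferMatrix V E b a A) : IsTransferMatrix W E b a A := by
  refine ⟨hA.1, fun y hy => ?_⟩
  obtain ⟨u, hu, hu1, hu2⟩ := exists_isSchrodingerSolution hV E a 1 0
  obtain ⟨v, hv, hv1, hv2⟩ := exists_isSchrodingerSolution hV E a 0 1
  have h1 := hu.wronskian_of_eqOn hy hab hVW
  have h2 := hv.wronskian_of_eqOn hy hab hVW
  have h3 := hA.2 u hu
  have h4 := hA.2 v hv
  have h5 := hA.1
  rw [hu1, hu2] at h1 h3
  rw [hv1, hv2] at h2 h4
  have e1 := congrFun h3 0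
  have e2 := congrFun h3 1
  have e3 := congrFun h4 0
  have e4 := congrFun h4 1
  simp [Matrix.mulVec, dotProduct] at e1 e2 e3 e4
  rw [← e1, ← e2] at h1
  rw [← e3, ← e4] at h2
  rw [Matrix.det_fin_two] at h5
  ext i
  fin_cases i
  · simp [Matrix.mulVec, dotProduct]
    linear_combination A 0 1 * h1 - A 0 0 * h2 + deriv y b * h5
  · simp [Matrix.mulVec, dotProduct]
    linear_combination A 1 1 * h1 - A 1 0 * h2 + y b * h5

theorem AbsolutelyContinuousOnInterval.comp_add_right {f : ℝ → ℝ} {a b p : ℝ}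
    (hf : AbsolutelyContinuousOnInterval f (a + p) (b + p)) :
    AbsolutelyContinuousOnInterval (fun t => f (t + p)) a b := by
  rw [absolutelyContinuousOnInterval_iff] at hf ⊢
  intro ε hε
  obtain ⟨δ, hδ, h⟩ := hf ε hε
  refine ⟨δ, hδ, fun I hI hlen => ?_⟩
  refine h (I.1, fun i => ((I.2 i).1 + p, (I.2 i).2 + p)) ⟨fun i hi => ?_, fun i hi j hj hij => ?_⟩
    (by simpa using hlen)
  · have := hI.1 i hi
    simp only [Set.mem_uIcc] at this ⊢
    simpa using this
  · have := hI.2 hi hj hij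
    simp only [Function.onFun, Set.disjoint_left, Set.mem_uIoc] at this ⊢
    intro t ht ht'
    exact this (a := t - p) (by grind) (by grind)

theorem IsSchrodingerSolution.comp_add_right {V : ℝ → ℝ} {E : ℝ} {y : ℝ → ℝ}
    (hy : IsSchrodingerSolution V E y) (p : ℝ) :
    IsSchrodingerSolution (fun t => V (t + p)) E fun t => y (t + p) := by
  have h1 : ∀ w : ℝ → ℝ, deriv (fun t => w (t + p)) = fun t => deriv w (t + p) := fun w =>
    funext fun t => deriv_comp_add_const w p t
  refine ⟨hy.differentiable.comp (differentiable_id.add_const p), fun a b => ?_, ?_⟩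
  · rw [h1]
    exact (hy.absolutelyContinuous_deriv _ _).comp_add_right
  · rw [h1, h1]
    exact (measurePreserving_add_right volume p).quasiMeasurePreserving.ae hy.equation

theorem IsTransferMatrix.of_comp_add_right {V : ℝ → ℝ} {E x x₀ p : ℝ}
    {A : Matrix (Fin 2) (Fin 2) ℝ} (hA : IsTransferMatrix (fun t => V (t + p)) E x x₀ A) :
    IsTransferMatrix V E (x + p) (x₀ + p) A := by
  refine ⟨hA.1, fun y hy => ?_⟩
  have := hA.2 _ (hy.comp_add_right p)
  rwa [deriv_comp_add_const, deriv_comp_add_const] at this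

theorem IsTransferMatrix.transferMatrix_eq {V : ℝ → ℝ} (hV : LocallyIntegrable V) {E x x₀ : ℝ}
    {A : Matrix (Fin 2) (Fin 2) ℝ} (hA : IsTransferMatrix V E x x₀ A) :
    transferMatrix V E x x₀ = A :=
  (existsUnique_isTransferMatrix hV E x x₀).unique (isTransferMatrix_transferMatrix hV E x x₀) hA

theorem transferMatrix_self {V : ℝ → ℝ} (hV : LocallyIntegrable V) (E x : ℝ) :
    transferMatrix V E x x = 1 :=
  IsTransferMatrix.transferMatrix_eq hV ⟨Matrix.det_one, fun _ _ => Matrix.one_mulVec _⟩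

theorem transferMatrix_mul {V : ℝ → ℝ} (hV : LocallyIntegrable V) (E x y z : ℝ) :
    transferMatrix V E x y * transferMatrix V E y z = transferMatrix V E x z := by
  have h1 := isTransferMatrix_transferMatrix hV E x y
  have h2 := isTransferMatrix_transferMatrix hV E y z
  refine (IsTransferMatrix.transferMatrix_eq hV ⟨?_, fun w hw => ?_⟩).symm
  · rw [Matrix.det_mul, h1.1, h2.1, one_mul]
  · rw [← Matrix.mulVec_mulVec, h2.2 w hw, h1.2 w hw]

theorem continuous_transferMatrix {V : ℝ → ℝ} (hV : LocallyIntegrable V) (E x₀ : ℝ) :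
    Continuous fun x => transferMatrix V E x x₀ := by
  obtain ⟨u, hu, hu1, hu2⟩ := exists_isSchrodingerSolution hV E x₀ 1 0
  obtain ⟨v, hv, hv1, hv2⟩ := exists_isSchrodingerSolution hV E x₀ 0 1
  have h : (fun x => transferMatrix V E x x₀) = fun x => !![deriv u x, deriv v x; u x, v x] := by
    funext x
    have h1 := (isTransferMatrix_transferMatrix hV E x x₀).2 u hu
    have h2 := (isTransferMatrix_transferMatrix hV E x x₀).2 v hv
    rw [hu1, hu2] at h1
    rw [hv1, hv2] at h2
    have e1 := congrFun h1 0
    have e2 := congrFun h1 1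
    have e3 := congrFun h2 0
    have e4 := congrFun h2 1
    simp [Matrix.mulVec, dotProduct] at e1 e2 e3 e4
    ext i j
    fin_cases i <;> fin_cases j <;> simp [e1, e2, e3, e4]
  rw [h]
  refine continuous_matrix fun i j => ?_
  fin_cases i <;> fin_cases j
  · exact hu.continuous_deriv
  · exact hv.continuous_deriv
  · exact hu.differentiable.continuous
  · exact hv.differentiable.continuous

/-! ### The cocycle of a subshift -/

theorem breakpoint_natCast (len : ℤ → ℝ) (n : ℕ) :
    breakpoint len n = ∑ k ∈ Finset.range n, len k := by
  induction n with
  | zero => simp [breakpoint_zero]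
  | succ n ih => rw [Finset.sum_range_succ, ← ih, ← breakpoint_succ]; simp

section Cocycle

variable {𝒜 : Type*} {ℓ : 𝒜 → ℝ} {f : 𝒜 → ℝ → ℝ}

/-- The transfer matrix from `0` to `t` over the piece of the letter `a`, for `t` in `[0, ℓ a]`,
realized by the periodic potential of the constant sequence `a`. -/
noncomputable def letterTransferMatrix (ℓ : 𝒜 → ℝ) (f : 𝒜 → ℝ → ℝ) (E : ℝ) (a : 𝒜) (t : ℝ) :
    Matrix (Fin 2) (Fin 2) ℝ :=
  transferMatrix (potential ℓ f fun _ => a) E t 0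

theorem potential_add_breakpoint (hℓ : ∀ a, 0 < ℓ a) (ω : ℤ → 𝒜) (n : ℤ) {t : ℝ}
    (ht : t ∈ Set.Ico 0 (ℓ (ω n))) :
    potential ℓ f ω (t + breakpoint (fun k => ℓ (ω k)) n) = f (ω n) t := by
  unfold potential
  rw [concatenation_of_mem (fun k => hℓ (ω k)) (fun k => f (ω k)) (n := n), add_sub_cancel_right]
  rw [breakpoint_succ]
  exact ⟨by linarith [ht.1], by linarith [ht.2]⟩

theorem iterate_leftShift (ω : ℤ → 𝒜) (m : ℕ) (k : ℤ) : leftShift^[m] ω k = ω (k + m) := by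
  induction m generalizing ω with
  | zero => simp
  | succ m ih =>
    rw [Function.iterate_succ_apply, ih]
    simp only [leftShift]
    congr 1
    push_cast
    ring

/-- The position of the `n`-th break point on the right half-line. -/
noncomputable def wordLength (ℓ : 𝒜 → ℝ) (ω : ℤ → 𝒜) (n : ℕ) : ℝ :=
  ∑ k ∈ Finset.range n, ℓ (ω k)

variable [Finite 𝒜] (hℓ : ∀ a, 0 < ℓ a)
  (hf : ∀ a, MemLp (f a) 2 (volume.restrict (Set.Ioo 0 (ℓ a))))
include hℓ hf

theorem det_letterTransferMatrix (E : ℝ) (a : 𝒜) (t : ℝ) :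
    (letterTransferMatrix ℓ f E a t).det = 1 :=
  (isTransferMatrix_transferMatrix (locallyIntegrable_potential hℓ hf _) E t 0).1

theorem det_transferMatrix_potential (E : ℝ) (ω : ℤ → 𝒜) (x x₀ : ℝ) :
    (transferMatrix (potential ℓ f ω) E x x₀).det = 1 :=
  (isTransferMatrix_transferMatrix (locallyIntegrable_potential hℓ hf _) E x x₀).1

/-- On the piece of the letter `ω n`, the matrix continues that of the preceding word by a matrix
which depends on `ω` through this letter only. -/
theorem transferMatrix_add_wordLength (E : ℝ) (ω : ℤ → 𝒜) (n : ℕ) {t : ℝ}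
    (ht : t ∈ Set.Icc 0 (ℓ (ω n))) :
    transferMatrix (potential ℓ f ω) E (wordLength ℓ ω n + t) 0 =
      letterTransferMatrix ℓ f E (ω n) t * wordTransferMatrix ℓ f E ω n := by
  have hV := locallyIntegrable_potential hℓ hf ω
  have hW := locallyIntegrable_potential hℓ hf (fun _ => ω n)
  have hb : breakpoint (fun k => ℓ (ω k)) n = wordLength ℓ ω n := breakpoint_natCast _ n
  have heq : Set.EqOn (potential ℓ f fun _ => ω n)
      (fun s => potential ℓ f ω (s + wordLength ℓ ω n)) (Set.Ico 0 t) := by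
    intro s hs
    have hs' : s ∈ Set.Ico 0 (ℓ (ω n)) := ⟨hs.1, hs.2.trans_le ht.2⟩
    have h1 := potential_add_breakpoint (f := f) hℓ (fun _ => ω n) 0 hs'
    rw [breakpoint_zero, add_zero] at h1
    rw [← hb]
    exact h1.trans (potential_add_breakpoint hℓ ω n hs').symm
  have h := ((isTransferMatrix_transferMatrix hW E t 0).of_eqOn hW ht.1 heq).of_comp_add_right
  rw [zero_add, add_comm t] at h
  rw [← transferMatrix_mul hV E _ (wordLength ℓ ω n) 0, h.transferMatrix_eq hV]
  rfl

theorem wordTransferMatrix_zero (E : ℝ) (ω : ℤ → 𝒜) : wordTransferMatrix ℓ f E ω 0 = 1 :=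
  transferMatrix_self (locallyIntegrable_potential hℓ hf ω) E 0

theorem wordTransferMatrix_succ (E : ℝ) (ω : ℤ → 𝒜) (n : ℕ) :
    wordTransferMatrix ℓ f E ω (n + 1) =
      letterTransferMatrix ℓ f E (ω n) (ℓ (ω n)) * wordTransferMatrix ℓ f E ω n := by
  rw [← transferMatrix_add_wordLength hℓ hf E ω n ⟨(hℓ _).le, le_rfl⟩]
  unfold wordTransferMatrix wordLength
  rw [Finset.sum_range_succ]

theorem det_wordTransferMatrix (E : ℝ) (ω : ℤ → 𝒜) (n : ℕ) :
    (wordTransferMatrix ℓ f E ω n).det = 1 :=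
  det_transferMatrix_potential hℓ hf E ω _ 0

theorem wordTransferMatrix_add (E : ℝ) (ω : ℤ → 𝒜) (m n : ℕ) :
    wordTransferMatrix ℓ f E ω (m + n) =
      wordTransferMatrix ℓ f E (leftShift^[m] ω) n * wordTransferMatrix ℓ f E ω m := by
  induction n with
  | zero => simp [wordTransferMatrix_zero hℓ hf]
  | succ n ih =>
    rw [← add_assoc, wordTransferMatrix_succ hℓ hf, ih, wordTransferMatrix_succ hℓ hf,
      iterate_leftShift, Matrix.mul_assoc]
    push_cast
    rw [add_comm (m : ℤ)]

/-- By compactness of `[0, ℓ a]` and finiteness of the alphabet, the transfer matrices over initial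
segments of the pieces are uniformly bounded. -/
theorem exists_log_norm_letterTransferMatrix_le (E : ℝ) :
    ∃ K, ∀ a, ∀ t ∈ Set.Icc 0 (ℓ a), Real.log ‖letterTransferMatrix ℓ f E a t‖ ≤ K := by
  have h1 : ∀ a, ∃ K, ∀ t ∈ Set.Icc 0 (ℓ a), Real.log ‖letterTransferMatrix ℓ f E a t‖ ≤ K := by
    intro a
    have hc : Continuous fun t => Real.log ‖letterTransferMatrix ℓ f E a t‖ := by
      refine (continuous_transferMatrix
        (locallyIntegrable_potential hℓ hf _) E 0).norm.log fun t => ?_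
      have := Matrix.one_le_norm_of_det_eq_one (det_letterTransferMatrix hℓ hf E a t)
      exact (zero_lt_one.trans_le this).ne'
    obtain ⟨K, hK⟩ :=
      (isCompact_Icc.bddAbove_image hc.continuousOn : BddAbove (_ '' Set.Icc 0 (ℓ a)))
    exact ⟨K, fun t ht => hK (Set.mem_image_of_mem _ ht)⟩
  choose K hK using h1
  obtain ⟨M, hM⟩ := (Set.finite_range K).bddAbove
  exact ⟨M, fun a t ht => (hK a t ht).trans (hM (Set.mem_range_self a))⟩

/-- Inside a piece, the norm of the transfer matrix stays comparable to that at the break point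
to the left. -/
theorem exists_abs_log_norm_transferMatrix_sub_le (E : ℝ) :
    ∃ K, ∀ (ω : ℤ → 𝒜) (n : ℕ), ∀ x ∈ Set.Icc (wordLength ℓ ω n) (wordLength ℓ ω (n + 1)),
      |Real.log ‖transferMatrix (potential ℓ f ω) E x 0‖ -
        Real.log ‖wordTransferMatrix ℓ f E ω n‖| ≤ K := by
  obtain ⟨K, hK⟩ := exists_log_norm_letterTransferMatrix_le hℓ hf E
  refine ⟨K, fun ω n x hx => ?_⟩
  have ht : x - wordLength ℓ ω n ∈ Set.Icc 0 (ℓ (ω n)) := by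
    have h1 : wordLength ℓ ω (n + 1) = wordLength ℓ ω n + ℓ (ω n) := Finset.sum_range_succ _ _
    rw [h1] at hx
    exact ⟨by linarith [hx.1], by linarith [hx.2]⟩
  have h := transferMatrix_add_wordLength hℓ hf E ω n ht
  rw [add_sub_cancel] at h
  rw [h]
  exact (Matrix.abs_log_norm_mul_sub_le (det_letterTransferMatrix hℓ hf E _ _)
    (det_wordTransferMatrix hℓ hf E ω n)).trans (hK _ _ ht)

theorem exists_abs_log_norm_wordTransferMatrix_le (E : ℝ) :
    ∃ C, ∀ (n : ℕ) (ω : ℤ → 𝒜), |Real.log ‖wordTransferMatrix ℓ f E ω n‖| ≤ C * n := by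
  obtain ⟨K, hK⟩ := exists_log_norm_letterTransferMatrix_le hℓ hf E
  refine ⟨K, fun n ω => ?_⟩
  induction n with
  | zero => simp [wordTransferMatrix_zero hℓ hf]
  | succ n ih =>
    rw [wordTransferMatrix_succ hℓ hf]
    have h1 := Matrix.abs_log_norm_mul_sub_le (det_letterTransferMatrix hℓ hf E (ω n) (ℓ (ω n)))
      (det_wordTransferMatrix hℓ hf E ω n)
    have h2 := hK (ω n) (ℓ (ω n)) ⟨(hℓ _).le, le_rfl⟩
    rw [abs_le] at h1 ih ⊢
    push_cast
    constructor <;> linarith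

theorem log_norm_wordTransferMatrix_add_le (E : ℝ) (ω : ℤ → 𝒜) (m n : ℕ) :
    Real.log ‖wordTransferMatrix ℓ f E ω (m + n)‖ ≤ Real.log ‖wordTransferMatrix ℓ f E ω m‖ +
      Real.log ‖wordTransferMatrix ℓ f E (leftShift^[m] ω) n‖ := by
  have h : ∀ ω k, 0 < ‖wordTransferMatrix ℓ f E ω k‖ := fun ω k =>
    zero_lt_one.trans_le (Matrix.one_le_norm_of_det_eq_one (det_wordTransferMatrix hℓ hf E ω k))
  rw [add_comm (Real.log _), ← Real.log_mul (h _ _).ne' (h _ _).ne']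
  refine Real.log_le_log (h _ _) ?_
  rw [wordTransferMatrix_add hℓ hf]
  exact norm_mul_le _ _

/-- The matrix is a product of matrices that depend on one letter each. -/
theorem measurable_log_norm_wordTransferMatrix [MeasurableSpace 𝒜] [DiscreteMeasurableSpace 𝒜]
    (E : ℝ) (n : ℕ) :
    Measurable fun ω : ℤ → 𝒜 => Real.log ‖wordTransferMatrix ℓ f E ω n‖ := by
  have hent : ∀ i j, Measurable fun ω : ℤ → 𝒜 => wordTransferMatrix ℓ f E ω n i j := by
    induction n with
    | zero => simp [wordTransferMatrix_zero hℓ hf]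
    | succ n ih =>
      intro i j
      simp_rw [wordTransferMatrix_succ hℓ hf, Matrix.mul_apply]
      refine Finset.measurable_sum _ fun k _ => Measurable.mul ?_ (ih k j)
      exact (Measurable.of_discrete
        (f := fun a : 𝒜 => letterTransferMatrix ℓ f E a (ℓ a) i k)).comp
          (measurable_pi_apply (n : ℤ))
  have hnorm : Measurable fun M : Fin 2 → Fin 2 → ℝ => ‖Matrix.of M‖ := by
    have : Continuous fun M : Fin 2 → Fin 2 → ℝ => ‖Matrix.of M‖ :=
      (continuous_id : Continuous fun M : Matrix (Fin 2) (Fin 2) ℝ => M).norm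
    exact this.measurable
  exact Real.measurable_log.comp
    (hnorm.comp (measurable_pi_iff.2 fun i => measurable_pi_iff.2 fun j => hent i j))

end Cocycle

section Subshift

variable {𝒜 : Type*} {Ω : Set (ℤ → 𝒜)}

theorem IsSubshift.coe_iterate_shift [TopologicalSpace 𝒜] (hΩ : IsSubshift Ω) (m : ℕ) (ω : Ω) :
    ((hΩ.shift^[m] ω : Ω) : ℤ → 𝒜) = leftShift^[m] (ω : ℤ → 𝒜) := by
  induction m generalizing ω with
  | zero => rfl
  | succ m ih => rw [Function.iterate_succ_apply, ih, Function.iterate_succ_apply]; rfl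

theorem IsSubshift.birkhoffSum_shift [TopologicalSpace 𝒜] (hΩ : IsSubshift Ω) (ℓ : 𝒜 → ℝ) (n : ℕ)
    (ω : Ω) :
    birkhoffSum hΩ.shift (fun ω : Ω => ℓ ((ω : ℤ → 𝒜) 0)) n ω = wordLength ℓ ω n := by
  refine Finset.sum_congr rfl fun k _ => ?_
  change ℓ ((hΩ.shift^[k] ω : ℤ → 𝒜) 0) = ℓ ((ω : ℤ → 𝒜) k)
  rw [hΩ.coe_iterate_shift, iterate_leftShift, zero_add]

theorem integral_comp_eval_zero [Fintype 𝒜] [MeasurableSpace 𝒜] [DiscreteMeasurableSpace 𝒜]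
    (μ : Measure Ω) [IsProbabilityMeasure μ] (ℓ : 𝒜 → ℝ) :
    ∫ ω : Ω, ℓ ((ω : ℤ → 𝒜) 0) ∂μ = ∑ a, ℓ a * μ.real {ω : Ω | (ω : ℤ → 𝒜) 0 = a} := by
  have hm : Measurable fun ω : Ω => (ω : ℤ → 𝒜) 0 :=
    (measurable_pi_apply 0).comp measurable_subtype_coe
  have := Measure.isProbabilityMeasure_map (μ := μ) hm.aemeasurable
  rw [← integral_map (φ := fun ω : Ω => (ω : ℤ → 𝒜) 0) (f := ℓ) hm.aemeasurable
    (Measurable.of_discrete).aestronglyMeasurable, integral_fintype .of_finite]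
  refine Finset.sum_congr rfl fun a _ => ?_
  rw [map_measureReal_apply hm (measurableSet_singleton a), smul_eq_mul, mul_comm]
  rfl

end Subshift

/-! ### From break points to the continuum -/

/-- If `G` stays within a bounded distance of `a n` on `[b n, b (n + 1)]`, where the steps of `b`
are positive and bounded, then growth rates along `b` pass to growth rates along the half-line. -/
theorem tendsto_div_of_abs_sub_le {a b : ℕ → ℝ} {G : ℝ → ℝ} {K Λ L s : ℝ} (hb0 : b 0 = 0)
    (hb : Monotone b) (hbΛ : ∀ n, b (n + 1) ≤ b n + Λ) (hs : 0 < s)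
    (hbs : Tendsto (fun n : ℕ => b n / n) atTop (𝓝 s))
    (haL : Tendsto (fun n : ℕ => a n / n) atTop (𝓝 L))
    (hG : ∀ n, ∀ x ∈ Set.Icc (b n) (b (n + 1)), |G x - a n| ≤ K) :
    Tendsto (fun x => G x / x) atTop (𝓝 (L / s)) := by
  have hbtop : Tendsto b atTop atTop := by
    refine (hbs.pos_mul_atTop hs tendsto_natCast_atTop_atTop).congr' ?_
    filter_upwards [eventually_gt_atTop 0] with n hn
    field_simp
  -- `ν x` is the number of the piece that contains `x`; then `x / ν x → s` and `G x / ν x → L`.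
  have hex : ∀ x, 0 ≤ x → ∃ n, b n ≤ x ∧ x < b (n + 1) := by
    intro x hx
    have h1 : ∃ n, x < b n := (hbtop.eventually_gt_atTop x).exists
    classical
    have h2 : Nat.find h1 ≠ 0 := fun h => by
      have := Nat.find_spec h1
      rw [h, hb0] at this
      linarith
    obtain ⟨n, hn⟩ := Nat.exists_eq_succ_of_ne_zero h2
    refine ⟨n, not_lt.1 (Nat.find_min h1 (by lia)), ?_⟩
    have := Nat.find_spec h1
    rwa [hn] at this
  choose! ν hν1 hν2 using hex
  have hνtop : Tendsto ν atTop atTop := by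
    refine tendsto_atTop.2 fun N => ?_
    filter_upwards [eventually_ge_atTop (b N), eventually_ge_atTop 0] with x hx hx0
    by_contra! h
    linarith [hν2 x hx0, hb (show ν x + 1 ≤ N by lia)]
  have hinv : Tendsto (fun x => ((ν x : ℝ))⁻¹) atTop (𝓝 0) :=
    tendsto_inv_atTop_zero.comp (tendsto_natCast_atTop_atTop.comp hνtop)
  have hb1 : Tendsto (fun x => b (ν x) / ν x) atTop (𝓝 s) := hbs.comp hνtop
  have ha1 : Tendsto (fun x => a (ν x) / ν x) atTop (𝓝 L) := haL.comp hνtop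
  have hxν : Tendsto (fun x => x / ν x) atTop (𝓝 s) := by
    have hup : Tendsto (fun x => b (ν x) / ν x + Λ * (ν x : ℝ)⁻¹) atTop (𝓝 s) := by
      simpa using hb1.add (hinv.const_mul Λ)
    refine tendsto_of_tendsto_of_tendsto_of_le_of_le' hb1 hup ?_ ?_
    · filter_upwards [eventually_ge_atTop 0] with x hx
      have := hν1 x hx
      gcongr
    · filter_upwards [eventually_ge_atTop 0] with x hx
      rw [← div_eq_mul_inv, ← add_div]
      have := (hν2 x hx).le.trans (hbΛ _)
      gcongr
  have hGν : Tendsto (fun x => G x / ν x) atTop (𝓝 L) := by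
    have hdiff : Tendsto (fun x => (G x - a (ν x)) * (ν x : ℝ)⁻¹) atTop (𝓝 0) := by
      refine squeeze_zero_norm' (a := fun x => K * (ν x : ℝ)⁻¹) ?_ (by simpa using hinv.const_mul K)
      filter_upwards [eventually_ge_atTop 0] with x hx
      rw [norm_mul, Real.norm_eq_abs, norm_inv, Real.norm_natCast]
      gcongr
      exact hG _ _ ⟨hν1 x hx, (hν2 x hx).le⟩
    have := ha1.add hdiff
    rw [add_zero] at this
    refine this.congr fun x => ?_
    ring
  refine (hGν.div hxν hs.ne').congr' ?_
  filter_upwards [hνtop.eventually_gt_atTop 0] with x hx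
  have : (ν x : ℝ) ≠ 0 := by exact_mod_cast hx.ne'
  simp only [Pi.div_apply]
  rw [div_div_div_cancel_right₀ this]

/-! ### The discrete and the continuum Lyapunov exponent -/

theorem mainTheorem11 {𝒜 : Type*} [Fintype 𝒜] [TopologicalSpace 𝒜] [DiscreteTopology 𝒜]
    [MeasurableSpace 𝒜] [DiscreteMeasurableSpace 𝒜]
    (ℓ : 𝒜 → ℝ) (hℓ : ∀ a, 0 < ℓ a)
    (f : 𝒜 → ℝ → ℝ) (hf : ∀ a, MemLp (f a) 2 (volume.restrict (Set.Ioo 0 (ℓ a))))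
    (Ω : Set (ℤ → 𝒜)) (hΩ : IsSubshift Ω)
    (μ : Measure Ω) [IsProbabilityMeasure μ] (hμ : Ergodic hΩ.shift μ) :
    ∃ Ldisc : ℝ → ℝ, ∀ E : ℝ,
      (∀ᵐ ω : Ω ∂μ, Tendsto
        (fun n : ℕ => (1 / (n : ℝ)) * Real.log ‖wordTransferMatrix ℓ f E (ω : ℤ → 𝒜) n‖)
        atTop (𝓝 (Ldisc E))) ∧
      (∀ᵐ ω : Ω ∂μ, Tendsto
        (fun x : ℝ => (1 / x) * Real.log ‖transferMatrix (potential ℓ f (ω : ℤ → 𝒜)) E x 0‖)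
        atTop (𝓝 (Ldisc E / ∑ a : 𝒜, ℓ a * μ.real {ω : Ω | (ω : ℤ → 𝒜) 0 = a}))) := by
  simp only [one_div_mul_eq_div]
  have hdisc : ∀ E, ∃ L, ∀ᵐ ω : Ω ∂μ, Tendsto
      (fun n : ℕ => Real.log ‖wordTransferMatrix ℓ f E (ω : ℤ → 𝒜) n‖ / n) atTop (𝓝 L) := by
    intro E
    obtain ⟨C, hC⟩ := exists_abs_log_norm_wordTransferMatrix_le hℓ hf E
    refine IsSubadditiveAlong.exists_ae_tendsto_div (C := C) hμ
      (g := fun n (ω : Ω) => Real.log ‖wordTransferMatrix ℓ f E (ω : ℤ → 𝒜) n‖)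
      (fun m n ω => ?_) (fun n => ?_) (fun n ω => hC n ω)
    · beta_reduce
      rw [hΩ.coe_iterate_shift]
      exact log_norm_wordTransferMatrix_add_le hℓ hf E ω m n
    · exact (measurable_log_norm_wordTransferMatrix hℓ hf E n).comp measurable_subtype_coe
  choose Ldisc hL using hdisc
  refine ⟨Ldisc, fun E => ⟨hL E, ?_⟩⟩
  obtain ⟨Λ, hΛ⟩ := (Set.finite_range ℓ).bddAbove
  have hΛ' : ∀ a, ℓ a ≤ Λ := fun a => hΛ (Set.mem_range_self a)
  have hm : Measurable fun ω : Ω => ℓ ((ω : ℤ → 𝒜) 0) :=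
    Measurable.of_discrete.comp ((measurable_pi_apply 0).comp measurable_subtype_coe)
  have hbd : ∀ ω : Ω, |ℓ ((ω : ℤ → 𝒜) 0)| ≤ Λ := fun ω => by
    rw [abs_of_pos (hℓ _)]; exact hΛ' _
  have hs : 0 < ∫ ω : Ω, ℓ ((ω : ℤ → 𝒜) 0) ∂μ := by
    rw [integral_pos_iff_support_of_nonneg (fun ω => (hℓ _).le)
      (Integrable.of_bound hm.aestronglyMeasurable Λ (ae_of_all _ hbd)),
      Function.support_eq_univ fun ω => (hℓ _).ne']
    simp
  obtain ⟨K, hK⟩ := exists_abs_log_norm_transferMatrix_sub_le hℓ hf E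
  filter_upwards [hL E, hμ.ae_tendsto_birkhoffSum_div hm hbd] with ω h1 h2
  simp only [hΩ.birkhoffSum_shift] at h2
  have hstep : ∀ n, wordLength ℓ ω (n + 1) = wordLength ℓ ω n + ℓ ((ω : ℤ → 𝒜) n) := fun n =>
    Finset.sum_range_succ _ _
  rw [← integral_comp_eval_zero]
  refine tendsto_div_of_abs_sub_le (Λ := Λ) (K := K) (Finset.sum_range_zero _) ?_ (fun n => ?_)
    hs h2 h1 (hK ω)
  · exact monotone_nat_of_le_succ fun n => by rw [hstep]; linarith [hℓ ((ω : ℤ → 𝒜) n)]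
  · rw [hstep]; linarith [hΛ' ((ω : ℤ → 𝒜) n)]
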